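/- Let $W\subseteq\mathbb{R}^n$ and let $\mathcal L:W\to\mathbb{R}$ be differentiable with gradient $\nabla\mathcal L$. For a step size $\Delta>0$ let $Q(v)=\Delta\,\mathrm{round}(v/\Delta)$, where $\mathrm{round}$ is rounding to the nearest integer, and for $g,u\in\mathbb{R}^n$ define the dithered quantization of $g$ with dither $u$ by $$\tilde g=\kappa\,\bigl(Q(g/\kappa+u)-u\bigr),\qquad \kappa=\|g\|_\infty=\max_i|g_i|,$$ where $Q$ acts coordinatewise and $\tilde g=0$ if $g=0$. On a probability space let $\xi_0,\xi_1,\dots$ be random samples and $u_0,u_1,\dots$ random vectors in $\mathbb{R}^n$, all mutually independent, such that every coordinate of every $u_t$ is uniformly distributed on $[-\Delta/2,\Delta/2]$ (the coordinates of one $u_t$ may be independent of each other, but need not be). Let $g(w;\xi)\in\mathbb{R}^n$ be a jointly measurable function giving unbiased, square integrable stochastic gradients: $\mathbb{E}\,g(w;\xi_t)=\nabla\mathcal L(w)$ and $\mathbb{E}\|g(w;\xi_t)\|_2^2<\infty$ for all $w\in W$ and all $t$. From a deterministic initial point $w_0$, consider the iteration $$w_{t+1}=w_t-\eta_t\,\tilde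 g_t,\qquad t=0,1,2,\dots,$$ with deterministic step sizes $\eta_t\ge 0$, where $\tilde g_t$ is the dithered quantization of $g(w_t;\xi_t)$ with dither $u_t$. The iterates are assumed to lie in $W$ almost surely (which is automatic for $W=\mathbb{R}^n$). **Theorem.** Assume that 1. $\mathcal L$ has a unique minimizer $w^*$ over $W$; 2. for every $\epsilon>0$, $\displaystyle\inf_{w\in W,\ \|w-w^*\|_2>\epsilon}(w-w^*)^{\mathsf T}\nabla\mathcal L(w)>0$ (the infimum of the empty set being $+\infty$); 3. $\sum_t\eta_t=+\infty$ and $\sum_t\eta_t^2<+\infty$; 4. there are constants $A,B\in\mathbb{R}$ such that $\mathbb{E}\|g(w;\xi_t)\|_2^2\le A+B\|w-w^*\|_2^2$ for all $w\in W$ and all $t$. Then for every quantization step size $0<\Delta\le 1$, $w_t\to w^*$ almost surely as $t\to\infty$. -/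

import Mathlib

open MeasureTheory ProbabilityTheory Filter Topology

/-- The uniform quantizer with step size `Δ`, centred at `0`: `Q(v) = Δ · round (v / Δ)`. -/
noncomputable def uniformQuantizer (Δ v : ℝ) : ℝ := Δ * (round (v / Δ) : ℝ)

/-- The dithered quantization of the vector `g` with dither vector `u`:
`κ (Q (g / κ + u) - u)` coordinatewise, with scale factor `κ = max_i |g_i|`
(the norm of the underlying element of `Fin n → ℝ`). It vanishes when `g = 0`. -/
noncomputable def ditheredQuantization {n : ℕ} (Δ : ℝ) (g : EuclideanSpace ℝ (Fin n))
    (u : Fin n → ℝ) : EuclideanSpace ℝ (Fin n) :=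
  WithLp.toLp 2 fun i =>
    ‖WithLp.ofLp g‖ * (uniformQuantizer Δ (g i / ‖WithLp.ofLp g‖ + u i) - u i)

/-- Stochastic gradient descent with dithered quantized stochastic gradients:
`w 0 = w₀` and `w (t+1) = w t - η t • g̃ t`, where `g̃ t` is the dithered quantization, with
dither `u t`, of the stochastic gradient `G (w t) (ξ t)` computed from the random sample `ξ t`. -/
noncomputable def ditheredSGD {n : ℕ} {Ω Ξ : Type*} (Δ : ℝ) (η : ℕ → ℝ)
    (G : EuclideanSpace ℝ (Fin n) → Ξ → EuclideanSpace ℝ (Fin n))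
    (ξ : ℕ → Ω → Ξ) (u : ℕ → Ω → Fin n → ℝ) (w₀ : EuclideanSpace ℝ (Fin n)) :
    ℕ → Ω → EuclideanSpace ℝ (Fin n)
  | 0, _ => w₀
  | t + 1, ω =>
      ditheredSGD Δ η G ξ u w₀ t ω -
        η t • ditheredQuantization Δ (G (ditheredSGD Δ η G ξ u w₀ t ω) (ξ t ω)) (u t ω)

/-- `w⋆` is the one and only minimizer of `L` over `W`. -/
def IsUniqueMinOn {E : Type*} (L : E → ℝ) (W : Set E) (wstar : E) : Prop :=
  wstar ∈ W ∧ IsMinOn L W wstar ∧ ∀ w ∈ W, IsMinOn L W w → w = wstar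

/-- The random vectors `u t` are dithers for step size `Δ`: measurable, with every coordinate
uniformly distributed on `[-Δ/2, Δ/2]`. The coordinates of one vector may be independent of
each other, but this is not required. -/
def IsUniformDither {n : ℕ} {Ω : Type*} [MeasurableSpace Ω] (μ : Measure Ω) (Δ : ℝ)
    (u : ℕ → Ω → Fin n → ℝ) : Prop :=
  ∀ t, Measurable (u t) ∧
    ∀ i, pdf.IsUniform (fun ω => u t ω i) (Set.Icc (-(Δ / 2)) (Δ / 2)) μ volume

/-! Dithered SGD is ordinary stochastic approximation whose noise is the pair (sample, dither). The
error `Q v - v` is `Δ`-periodic with mean zero over a period, so averaging over a uniform dither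
removes it. Quantization is thus unbiased at each fixed gradient and, by freezing the sample, at a
random one (`integral_ditheredQuantization_comp`). For `Δ ≤ 1` it enlarges the norm by at most
`2√n`, so quadratic growth survives.

Convergence is then a Robbins–Monro argument. With `V t = ‖w t - w*‖²`, expanding one step gives
`E[V (t+1) | past] ≤ (1 + η²B) V t - 2η ⟨w t - w*, ∇L⟩ + η²A`. By `robbins_siegmund`, almost surely
`V t` converges and `∑ η ⟨w t - w*, ∇L⟩` is finite. A positive limit would keep these inner products
away from zero and force `∑ η < ∞` (`tendsto_of_summable_descent`). -/

/-! ### Decoupling of independent variables -/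

/-- If `X` and `Y` are independent, then a function of `(X, Y)` has the same integrability under
`μ` as its decoupled version under `μ.prod μ`. -/
lemma ProbabilityTheory.IndepFun.integrable_comp_iff_prod {Ω α β E : Type*} [MeasurableSpace Ω]
    [MeasurableSpace α] [MeasurableSpace β] [NormedAddCommGroup E] {μ : Measure Ω}
    [IsProbabilityMeasure μ] {X : Ω → α} {Y : Ω → β} (h : IndepFun X Y μ) (hX : Measurable X)
    (hY : Measurable Y) {F : α × β → E} (hF : StronglyMeasurable F) :
    Integrable (fun ω => F (X ω, Y ω)) μ ↔
      Integrable (fun p : Ω × Ω => F (X p.1, Y p.2)) (μ.prod μ) := by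
  have h1 := (indepFun_iff_map_prod_eq_prod_map_map hX.aemeasurable hY.aemeasurable).1 h
  rw [Measure.map_prod_map _ _ hX hY] at h1
  have h2 := integrable_map_measure (μ := μ) (f := fun ω => (X ω, Y ω)) (g := F)
    hF.aestronglyMeasurable (hX.prodMk hY).aemeasurable
  rw [h1, integrable_map_measure hF.aestronglyMeasurable (hX.prodMap hY).aemeasurable] at h2
  exact h2.symm

/-- If `X` and `Y` are independent, then a function of `(X, Y)` is integrated by freezing `X`. -/
lemma ProbabilityTheory.IndepFun.integral_comp_eq_integral_integral {Ω α β E : Type*}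
    [MeasurableSpace Ω] [MeasurableSpace α] [MeasurableSpace β] [NormedAddCommGroup E]
    [NormedSpace ℝ E] {μ : Measure Ω} [IsProbabilityMeasure μ] {X : Ω → α} {Y : Ω → β}
    (h : IndepFun X Y μ) (hX : Measurable X) (hY : Measurable Y) {F : α × β → E}
    (hF : StronglyMeasurable F) (hint : Integrable (fun ω => F (X ω, Y ω)) μ) :
    ∫ ω, F (X ω, Y ω) ∂μ = ∫ ω, ∫ ω', F (X ω, Y ω') ∂μ ∂μ := by
  have h1 := (indepFun_iff_map_prod_eq_prod_map_map hX.aemeasurable hY.aemeasurable).1 h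
  rw [Measure.map_prod_map _ _ hX hY] at h1
  have h2 := integral_map (μ := μ) (φ := fun ω => (X ω, Y ω)) (f := F)
    (hX.prodMk hY).aemeasurable hF.aestronglyMeasurable
  rw [h1, integral_map (hX.prodMap hY).aemeasurable hF.aestronglyMeasurable] at h2
  rw [← h2]
  exact integral_prod _ ((h.integrable_comp_iff_prod hX hY hF).1 hint)

/-! ### Almost supermartingales -/

/-- If `b` is nonnegative and summable, the partial products of
`1 + b` converge to a positive limit. -/
lemma exists_tendsto_prod_one_add {b : ℕ → ℝ} (hb : ∀ t, 0 ≤ b t) (hbs : Summable b) :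
    ∃ p : ℝ, 1 ≤ p ∧ (∀ t, ∏ s ∈ Finset.range t, (1 + b s) ≤ p) ∧
      Tendsto (fun t => ∏ s ∈ Finset.range t, (1 + b s)) atTop (𝓝 p) := by
  have hmono : Monotone fun t => ∏ s ∈ Finset.range t, (1 + b s) := by
    refine monotone_nat_of_le_succ fun t => ?_
    rw [Finset.prod_range_succ]
    exact le_mul_of_one_le_right (Finset.prod_nonneg fun s _ => by linarith [hb s])
      (by linarith [hb t])
  have hbdd : BddAbove (Set.range fun t => ∏ s ∈ Finset.range t, (1 + b s)) := by
    refine ⟨Real.exp (∑' s, b s), ?_⟩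
    rintro _ ⟨t, rfl⟩
    exact (Real.prod_one_add_le_exp_sum _ hb).trans
      (Real.exp_le_exp.2 (hbs.sum_le_tsum _ fun s _ => hb s))
  have hlim := tendsto_atTop_ciSup hmono hbdd
  exact ⟨_, by simpa using hmono.ge_of_tendsto hlim 0, hmono.ge_of_tendsto hlim, hlim⟩

/-- **Robbins–Siegmund theorem**, for deterministic perturbations `b` and `c`. The almost
supermartingale inequality is stated through integrals over the sets of the filtration. -/
theorem robbins_siegmund {Ω : Type*} {m0 : MeasurableSpace Ω} {μ : Measure Ω}
    [IsFiniteMeasure μ] {ℱ : Filtration ℕ m0} {V X : ℕ → Ω → ℝ} {b c : ℕ → ℝ}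
    (hV_adapted : StronglyAdapted ℱ V) (hX_adapted : StronglyAdapted ℱ X)
    (hV_int : ∀ t, Integrable (V t) μ) (hX_int : ∀ t, Integrable (X t) μ)
    (hV : ∀ t ω, 0 ≤ V t ω) (hX : ∀ t, ∀ᵐ ω ∂μ, 0 ≤ X t ω)
    (hb : ∀ t, 0 ≤ b t) (hc : ∀ t, 0 ≤ c t) (hbs : Summable b) (hcs : Summable c)
    (hstep : ∀ t, ∀ s, MeasurableSet[ℱ t] s →
      ∫ ω in s, V (t + 1) ω ∂μ ≤ ∫ ω in s, ((1 + b t) * V t ω - X t ω + c t) ∂μ) :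
    ∀ᵐ ω ∂μ, (∃ l, Tendsto (fun t => V t ω) atTop (𝓝 l)) ∧ Summable fun t => X t ω := by
  obtain ⟨p, hp1, hp_le, hp⟩ := exists_tendsto_prod_one_add hb hbs
  -- This integrating factor absorbs the growth `1 + b t`; it stays in `[p⁻¹, 1]`, so weighting by
  -- it loses neither convergence nor summability.
  set a : ℕ → ℝ := fun t => (∏ s ∈ Finset.range t, (1 + b s))⁻¹ with ha
  have hprod_pos : ∀ t, 0 < ∏ s ∈ Finset.range t, (1 + b s) := fun t =>
    Finset.prod_pos fun s _ => by linarith [hb s]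
  have ha_pos : ∀ t, 0 < a t := fun t => inv_pos.2 (hprod_pos t)
  have ha_succ : ∀ t, a (t + 1) * (1 + b t) = a t := fun t => by
    have h1 : (1 + b t) ≠ 0 := by linarith [hb t]
    simp only [ha, Finset.prod_range_succ, mul_inv]
    field_simp
  have ha_le_one : ∀ t, a t ≤ 1 := fun t => by
    refine inv_le_one_of_one_le₀ ?_
    simpa using Finset.prod_le_prod (s := Finset.range t) (f := fun _ => (1 : ℝ))
      (g := fun s => 1 + b s) (fun _ _ => zero_le_one) fun s _ => by linarith [hb s]
  have ha_ge : ∀ t, p⁻¹ ≤ a t := fun t => inv_anti₀ (hprod_pos t) (hp_le t)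
  have hacs : Summable fun t => a (t + 1) * c t :=
    hcs.of_nonneg_of_le (fun t => mul_nonneg (ha_pos _).le (hc t)) fun t =>
      mul_le_of_le_one_left (hc t) (ha_le_one _)
  set C := ∑' t, a (t + 1) * c t
  -- Adding the tail of `∑ a (t+1) c t` instead of subtracting its partial sums keeps `Z`
  -- nonnegative.
  set Z : ℕ → Ω → ℝ := fun t ω => a t * V t ω + ∑ s ∈ Finset.range t, a (s + 1) * X s ω +
    (C - ∑ s ∈ Finset.range t, a (s + 1) * c s) with hZ
  have hZ_int : ∀ t, Integrable (Z t) μ := fun t =>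
    (((hV_int t).const_mul _).add (integrable_finsetSum _ fun s _ =>
      (hX_int s).const_mul _)).add (integrable_const _)
  have hZ_super : Supermartingale Z ℱ μ := by
    refine supermartingale_of_setIntegral_succ_le (fun t => ?_) hZ_int fun t s hs => ?_
    · refine (((hV_adapted t).const_mul _).add ?_).add stronglyMeasurable_const
      refine Finset.stronglyMeasurable_fun_sum _ fun s hs => ?_
      exact ((hX_adapted s).mono (ℱ.mono (Finset.mem_range.1 hs).le)).const_mul _
    · have e1 : Z (t + 1) = fun ω => a (t + 1) * V (t + 1) ω +
          (Z t ω - a (t + 1) * ((1 + b t) * V t ω - X t ω + c t)) := by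
        funext ω
        simp only [hZ, Finset.sum_range_succ]
        linear_combination V t ω * ha_succ t
      have i1 : Integrable (fun ω => (1 + b t) * V t ω - X t ω + c t) μ :=
        (((hV_int t).const_mul _).sub (hX_int t)).add (integrable_const _)
      have i2 : Integrable (fun ω => Z t ω - a (t + 1) * ((1 + b t) * V t ω - X t ω + c t)) μ :=
        (hZ_int t).sub (i1.const_mul _)
      simp only [e1]
      rw [integral_add ((hV_int _).const_mul _).integrableOn i2.integrableOn, integral_sub (hZ_int t).integrableOn (i1.const_mul _).integrableOn,
        integral_const_mul, integral_const_mul]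
      nlinarith [mul_le_mul_of_nonneg_left (hstep t s hs) (ha_pos (t + 1)).le]
  have hXall : ∀ᵐ ω ∂μ, ∀ t, 0 ≤ X t ω := ae_all_iff.2 hX
  have hC_le : ∀ t, ∑ s ∈ Finset.range t, a (s + 1) * c s ≤ C := fun t =>
    hacs.sum_le_tsum _ fun s _ => mul_nonneg (ha_pos _).le (hc s)
  have hZ_nonneg : ∀ t, 0 ≤ᵐ[μ] Z t := fun t => by
    filter_upwards [hXall] with ω hω
    have h1 := mul_nonneg (ha_pos t).le (hV t ω)
    have h2 : 0 ≤ ∑ s ∈ Finset.range t, a (s + 1) * X s ω :=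
      Finset.sum_nonneg fun s _ => mul_nonneg (ha_pos _).le (hω s)
    have h3 := hC_le t
    simp only [hZ, Pi.zero_apply]
    linarith
  -- For a nonnegative supermartingale the L¹ norm is the mean, which is at most the initial mean;
  -- Doob's theorem is applied to the submartingale `-Z`.
  have hZ_bdd : ∀ t, eLpNorm ((-Z) t) 1 μ ≤ ((∫ ω, Z 0 ω ∂μ).toNNReal : ENNReal) := fun t => by
    rw [Pi.neg_apply, eLpNorm_neg, eLpNorm_one_eq_lintegral_enorm,
      ← ofReal_integral_norm_eq_lintegral_enorm (hZ_int t)]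
    refine ENNReal.ofReal_le_ofReal ?_
    have e : ∫ ω, ‖Z t ω‖ ∂μ = ∫ ω, Z t ω ∂μ := integral_congr_ae <| by
      filter_upwards [hZ_nonneg t] with ω hω using Real.norm_of_nonneg hω
    rw [e]
    simpa using hZ_super.setIntegral_le (Nat.zero_le t) MeasurableSet.univ
  filter_upwards [hZ_super.neg.exists_ae_tendsto_of_bdd hZ_bdd, hXall] with ω ⟨l, hl⟩ hω
  have hZl : Tendsto (fun t => Z t ω) atTop (𝓝 (-l)) := by simpa using hl.neg
  have haX : ∀ s, 0 ≤ a (s + 1) * X s ω := fun s => mul_nonneg (ha_pos _).le (hω s)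
  have hsum : Summable fun s => a (s + 1) * X s ω := by
    obtain ⟨M, hM⟩ := hZl.bddAbove_range
    refine summable_of_sum_range_le haX (c := M) fun t => ?_
    have h1 : Z t ω ≤ M := hM ⟨t, rfl⟩
    have h2 := mul_nonneg (ha_pos t).le (hV t ω)
    have h3 := hC_le t
    simp only [hZ] at h1
    linarith
  refine ⟨?_, ?_⟩
  · have h1 : Tendsto (fun t => a t * V t ω) atTop
        (𝓝 (-l - ∑' s, a (s + 1) * X s ω - (C - C))) := by
      refine ((hZl.sub hsum.hasSum.tendsto_sum_nat).sub
        (tendsto_const_nhds.sub hacs.hasSum.tendsto_sum_nat)).congr fun t => ?_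
      simp only [hZ]
      ring
    refine ⟨_, (hp.mul h1).congr fun t => ?_⟩
    simp only [ha]
    rw [mul_inv_cancel_left₀ (hprod_pos t).ne']
  · refine (hsum.mul_left p).of_nonneg_of_le hω fun s => ?_
    have h1 := mul_le_mul_of_nonneg_right (ha_ge (s + 1)) (hω s)
    calc X s ω = p * (p⁻¹ * X s ω) := by field_simp
      _ ≤ _ := mul_le_mul_of_nonneg_left h1 (by linarith)

/-! ### The past and its independence from the present sample -/

/-- The filtration generated by the samples `y s` drawn strictly before time `t`. -/
def pastFiltration {Ω S : Type*} [m0 : MeasurableSpace Ω] [mS : MeasurableSpace S]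
    (y : ℕ → Ω → S) (hy : ∀ t, Measurable (y t)) : Filtration ℕ m0 where
  seq t := ⨆ s ∈ Set.Iio t, mS.comap (y s)
  mono' _ _ hij := biSup_mono fun _ hs => lt_of_lt_of_le hs hij
  le' _ := iSup₂_le fun s _ => (hy s).comap_le

lemma measurable_pastFiltration {Ω S : Type*} [MeasurableSpace Ω] [mS : MeasurableSpace S]
    {y : ℕ → Ω → S} (hy : ∀ t, Measurable (y t)) {s t : ℕ} (hst : s < t) :
    Measurable[pastFiltration y hy t] (y s) :=
  measurable_iff_comap_le.2 (le_iSup₂_of_le (f := fun s (_ : s ∈ Set.Iio t) => mS.comap (y s))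
    s hst le_rfl)

lemma ProbabilityTheory.iIndepFun.indepFun_of_measurable_past {Ω S α : Type*} [MeasurableSpace Ω]
    [mS : MeasurableSpace S] [mα : MeasurableSpace α] {μ : Measure Ω} {y : ℕ → Ω → S}
    (h : iIndepFun y μ) (hy : ∀ t, Measurable (y t)) {t : ℕ} {X : Ω → α}
    (hX : Measurable[pastFiltration y hy t] X) : IndepFun X (y t) μ := by
  have h1 : Indep (⨆ s ∈ Set.Iio t, mS.comap (y s)) (⨆ s ∈ ({t} : Set ℕ), mS.comap (y s)) μ :=
    indep_iSup_of_disjoint (fun s => (hy s).comap_le) h.iIndep (by simp)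
  rw [iSup_singleton] at h1
  exact indep_of_indep_of_le_left h1 (measurable_iff_comap_le.1 hX)

/-! ### Robbins–Monro convergence -/

section RobbinsMonro

variable {E : Type*} [NormedAddCommGroup E] [InnerProductSpace ℝ E]

/-- The expected squared distance to `wstar` after one stochastic gradient step. -/
lemma integral_norm_sub_smul_sq [CompleteSpace E] {Ω : Type*} [MeasurableSpace Ω] {μ : Measure Ω}
    [IsProbabilityMeasure μ] {h : Ω → E} (hh : MemLp h 2 μ) (v : E) (r : ℝ) :
    Integrable (fun ω => ‖v - r • h ω‖ ^ 2) μ ∧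
      ∫ ω, ‖v - r • h ω‖ ^ 2 ∂μ =
        ‖v‖ ^ 2 - 2 * r * inner ℝ v (∫ ω, h ω ∂μ) + r ^ 2 * ∫ ω, ‖h ω‖ ^ 2 ∂μ := by
  have h1 : Integrable h μ := hh.integrable one_le_two
  have h2 : Integrable (fun ω => ‖h ω‖ ^ 2) μ := hh.integrable_norm_pow two_ne_zero
  have h3 : Integrable (fun ω => 2 * r * inner ℝ v (h ω)) μ := (h1.const_inner v).const_mul _
  have e : (fun ω => ‖v - r • h ω‖ ^ 2) =
      fun ω => ‖v‖ ^ 2 - 2 * r * inner ℝ v (h ω) + r ^ 2 * ‖h ω‖ ^ 2 := by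
    funext ω
    rw [norm_sub_sq_real, inner_smul_right, norm_smul, mul_pow, Real.norm_eq_abs, sq_abs]
    ring
  have h4 : Integrable (fun ω => ‖v‖ ^ 2 - 2 * r * inner ℝ v (h ω)) μ :=
    (integrable_const _).sub h3
  rw [e]
  refine ⟨h4.add (h2.const_mul _), ?_⟩
  rw [integral_add h4 (h2.const_mul _), integral_sub (integrable_const _) h3, integral_const_mul,
    integral_const_mul, integral_inner h1]
  simp

/-- If the squared distances to `wstar` converge and the weighted descent terms are summable for
weights with divergent sum, then the sequence converges to `wstar`. -/
lemma tendsto_of_summable_descent {W : Set E} {gradL : E → E} {wstar : E}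
    (hdescent : ∀ ε : ℝ, 0 < ε → ∃ δ : ℝ, 0 < δ ∧ ∀ w ∈ W, ε < ‖w - wstar‖ →
      δ ≤ inner ℝ (w - wstar) (gradL w))
    {η : ℕ → ℝ} (hη : ∀ t, 0 ≤ η t)
    (hη_sum : Tendsto (fun T => ∑ t ∈ Finset.range T, η t) atTop atTop)
    {w : ℕ → E} (hw : ∀ t, w t ∈ W) {l : ℝ}
    (hl : Tendsto (fun t => ‖w t - wstar‖ ^ 2) atTop (𝓝 l))
    (hsum : Summable fun t => η t * inner ℝ (w t - wstar) (gradL (w t))) :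
    Tendsto w atTop (𝓝 wstar) := by
  have hl0 : 0 ≤ l := ge_of_tendsto' hl fun t => sq_nonneg _
  have hsqrt : Tendsto (fun t => ‖w t - wstar‖) atTop (𝓝 (√l)) :=
    hl.sqrt.congr fun t => Real.sqrt_sq (norm_nonneg _)
  rcases hl0.eq_or_lt with h0 | hpos
  · rw [← h0, Real.sqrt_zero] at hsqrt
    exact tendsto_iff_norm_sub_tendsto_zero.2 hsqrt
  exfalso
  have hs : 0 < √l := Real.sqrt_pos.2 hpos
  obtain ⟨δ, hδ, hδle⟩ := hdescent (√l / 2) (by positivity)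
  have hev : ∀ᶠ t in atTop, √l / 2 < ‖w t - wstar‖ :=
    hsqrt.eventually_const_lt (by linarith)
  -- Eventually `η t * δ` is at most the summable descent term.
  have hη_summable : Summable η := by
    refine (hsum.mul_left δ⁻¹).of_norm_bounded_eventually_nat ?_
    filter_upwards [hev] with t ht
    rw [Real.norm_of_nonneg (hη t)]
    calc η t = δ⁻¹ * (η t * δ) := by field_simp
      _ ≤ _ := by gcongr; exacts [hη t, hδle _ (hw t) ht]
  exact not_tendsto_nhds_of_tendsto_atTop hη_sum _ hη_summable.hasSum.tendsto_sum_nat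

variable [CompleteSpace E] [MeasurableSpace E] [BorelSpace E] [SecondCountableTopology E]

/-- Almost sure convergence of stochastic gradient descent with independent samples `y t`,
square integrable unbiased stochastic gradients `H w (y t)` of at most quadratic growth, and step
sizes `η t` satisfying the Robbins–Monro conditions. -/
theorem ae_tendsto_of_robbins_monro {Ω S : Type*} [MeasurableSpace Ω] [MeasurableSpace S]
    {μ : Measure Ω} [IsProbabilityMeasure μ] {W : Set E} {gradL : E → E} {wstar : E}
    (hdescent : ∀ ε : ℝ, 0 < ε → ∃ δ : ℝ, 0 < δ ∧ ∀ w ∈ W, ε < ‖w - wstar‖ →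
      δ ≤ inner ℝ (w - wstar) (gradL w))
    {η : ℕ → ℝ} (hη : ∀ t, 0 ≤ η t)
    (hη_sum : Tendsto (fun T => ∑ t ∈ Finset.range T, η t) atTop atTop)
    (hη_sq : Summable fun t => η t ^ 2)
    {H : E → S → E} (hH : Measurable (Function.uncurry H))
    {y : ℕ → Ω → S} (hy : ∀ t, Measurable (y t)) (hy_indep : iIndepFun y μ)
    (hH_L2 : ∀ t, ∀ w ∈ W, MemLp (fun ω => H w (y t ω)) 2 μ)
    (hH_unbiased : ∀ t, ∀ w ∈ W, ∫ ω, H w (y t ω) ∂μ = gradL w)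
    {A B : ℝ} (hA : 0 ≤ A) (hB : 0 ≤ B)
    (hH_bound : ∀ t, ∀ w ∈ W, ∫ ω, ‖H w (y t ω)‖ ^ 2 ∂μ ≤ A + B * ‖w - wstar‖ ^ 2)
    {x : ℕ → Ω → E} {w₀ : E} (hx_zero : ∀ ω, x 0 ω = w₀)
    (hx_succ : ∀ t ω, x (t + 1) ω = x t ω - η t • H (x t ω) (y t ω))
    (hW : ∀ t, ∀ᵐ ω ∂μ, x t ω ∈ W) :
    ∀ᵐ ω ∂μ, Tendsto (fun t => x t ω) atTop (𝓝 wstar) := by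
  set ℱ := pastFiltration y hy
  -- the iterates are adapted
  have hx_meas : ∀ t, Measurable[ℱ t] (x t) := fun t => by
    induction t with
    | zero => rw [show x 0 = fun _ => w₀ from funext hx_zero]; exact measurable_const
    | succ t ih =>
      rw [show x (t + 1) = fun ω => x t ω - η t • H (x t ω) (y t ω) from funext (hx_succ t)]
      have h1 : Measurable[ℱ (t + 1)] (x t) := ih.mono (ℱ.mono t.le_succ) le_rfl
      have h2 : Measurable[ℱ (t + 1)] (y t) := measurable_pastFiltration hy t.lt_succ_self
      exact h1.sub ((hH.comp (h1.prodMk h2)).const_smul (η t))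
  have hx_meas' : ∀ t, Measurable (x t) := fun t => (hx_meas t).mono (ℱ.le t) le_rfl
  -- a measurable version of the gradient
  set m : ℕ → E → E := fun t w => ∫ ω, H w (y t ω) ∂μ with hm
  have hm_meas : ∀ t, StronglyMeasurable (m t) := fun t => by
    refine StronglyMeasurable.integral_prod_right (f := fun w ω => H w (y t ω)) ?_
    exact (hH.comp (measurable_fst.prodMk ((hy t).comp measurable_snd))).stronglyMeasurable
  have hinner_nonneg : ∀ w ∈ W, 0 ≤ inner ℝ (w - wstar) (gradL w) := fun w hw => by
    rcases eq_or_ne w wstar with rfl | hne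
    · simp
    · have hpos : 0 < ‖w - wstar‖ := norm_pos_iff.2 (sub_ne_zero.2 hne)
      obtain ⟨δ, hδ, h⟩ := hdescent (‖w - wstar‖ / 2) (by positivity)
      exact hδ.le.trans (h w hw (by linarith))
  set V : ℕ → Ω → ℝ := fun t ω => ‖x t ω - wstar‖ ^ 2 with hV
  set X : ℕ → Ω → ℝ := fun t ω => 2 * η t * inner ℝ (x t ω - wstar) (m t (x t ω)) with hX
  -- The mean of the next squared distance from a frozen iterate `w`; at `x t` it plays the role of
  -- `E[V (t+1) | past]`.
  set φ : ℕ → E → ℝ := fun t w => ∫ ω, ‖w - wstar - η t • H w (y t ω)‖ ^ 2 ∂μ with hφ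
  have hφ_meas : ∀ t, StronglyMeasurable (φ t) := fun t => by
    refine StronglyMeasurable.integral_prod_right
      (f := fun w ω => ‖w - wstar - η t • H w (y t ω)‖ ^ 2) ?_
    exact (((measurable_fst.sub_const wstar).sub ((hH.comp (measurable_fst.prodMk
      ((hy t).comp measurable_snd))).const_smul (η t))).norm.pow_const 2).stronglyMeasurable
  have hφ_nonneg : ∀ t w, 0 ≤ φ t w := fun t w => integral_nonneg fun ω => sq_nonneg _
  have hφ_le : ∀ t, ∀ w ∈ W, φ t w ≤ (1 + η t ^ 2 * B) * ‖w - wstar‖ ^ 2 -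
      2 * η t * inner ℝ (w - wstar) (m t w) + η t ^ 2 * A := fun t w hw => by
    have h1 := (integral_norm_sub_smul_sq (hH_L2 t w hw) (w - wstar) (η t)).2
    have h2 := mul_le_mul_of_nonneg_left (hH_bound t w hw) (sq_nonneg (η t))
    simp only [hφ, hm]
    rw [h1]
    linarith
  have hV_meas : ∀ t, Measurable[ℱ t] (V t) := fun t =>
    ((measurable_id.sub_const wstar).norm.pow_const 2).comp (hx_meas t)
  have hX_meas : ∀ t, Measurable[ℱ t] (X t) := fun t =>
    (((measurable_id.sub_const wstar).inner (hm_meas t).measurable).const_mul (2 * η t)).comp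
      (hx_meas t)
  have hX_nonneg : ∀ t, ∀ᵐ ω ∂μ, 0 ≤ X t ω := fun t => by
    filter_upwards [hW t] with ω hω
    simp only [hX, hm]
    rw [hH_unbiased t _ hω]
    exact mul_nonneg (mul_nonneg zero_le_two (hη t)) (hinner_nonneg _ hω)
  have hdom : ∀ t, ∀ᵐ ω ∂μ, φ t (x t ω) ≤
      (1 + η t ^ 2 * B) * V t ω - X t ω + η t ^ 2 * A := fun t => by
    filter_upwards [hW t] with ω hω using hφ_le t _ hω
  -- Since `φ ≥ 0`, the one-step bound `hdom` also dominates `X t` by an affine function of `V t`.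
  have hX_int : ∀ t, Integrable (V t) μ → Integrable (X t) μ := fun t hVt => by
    refine ((hVt.const_mul (1 + η t ^ 2 * B)).add (integrable_const (η t ^ 2 * A))).mono'
      ((hX_meas t).mono (ℱ.le t) le_rfl).aestronglyMeasurable ?_
    filter_upwards [hX_nonneg t, hdom t] with ω h1 h2
    rw [Real.norm_of_nonneg h1]
    have := hφ_nonneg t (x t ω)
    simp only [Pi.add_apply]
    linarith
  have hφ_int : ∀ t, Integrable (V t) μ → Integrable (fun ω => φ t (x t ω)) μ := fun t hVt => by
    refine ((hVt.const_mul (1 + η t ^ 2 * B)).add (integrable_const (η t ^ 2 * A))).mono'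
      ((hφ_meas t).measurable.comp (hx_meas' t)).aestronglyMeasurable ?_
    filter_upwards [hX_nonneg t, hdom t] with ω h1 h2
    rw [Real.norm_of_nonneg (hφ_nonneg t _)]
    simp only [Pi.add_apply]
    linarith
  have hV_succ : ∀ t, V (t + 1) = fun ω => ‖x t ω - wstar - η t • H (x t ω) (y t ω)‖ ^ 2 :=
    fun t => by
      funext ω
      simp only [hV, hx_succ]
      rw [sub_right_comm]
  have hV_int_succ : ∀ t, Integrable (V t) μ → Integrable (V (t + 1)) μ := fun t hVt => by
    have hF : Measurable fun p : E × S => ‖p.1 - wstar - η t • H p.1 p.2‖ ^ 2 :=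
      ((measurable_fst.sub_const wstar).sub (hH.const_smul (η t))).norm.pow_const 2
    rw [hV_succ, (hy_indep.indepFun_of_measurable_past hy (hx_meas t)).integrable_comp_iff_prod
      (hx_meas' t) (hy t) hF.stronglyMeasurable]
    refine (integrable_prod_iff (hF.comp (((hx_meas' t).comp measurable_fst).prodMk
      ((hy t).comp measurable_snd))).aestronglyMeasurable).2 ⟨?_, (hφ_int t hVt).congr (Eventually.of_forall fun ω => ?_)⟩
    · filter_upwards [hW t] with ω hω using
        (integral_norm_sub_smul_sq (hH_L2 t _ hω) (x t ω - wstar) (η t)).1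
    · simp [hφ]
  have hV_int : ∀ t, Integrable (V t) μ := fun t => by
    induction t with
    | zero => simp only [hV, hx_zero]; exact integrable_const _
    | succ t ih => exact hV_int_succ t ih
  have hstep : ∀ t, ∀ s, MeasurableSet[ℱ t] s → ∫ ω in s, V (t + 1) ω ∂μ ≤
      ∫ ω in s, ((1 + η t ^ 2 * B) * V t ω - X t ω + η t ^ 2 * A) ∂μ := fun t s hs => by
    have hs' := ℱ.le t s hs
    -- The indicator of `s` is frozen together with `x t`, both being functions of the past; this
    -- replaces conditional expectation.
    have hind : Measurable[ℱ t] (s.indicator fun _ => (1 : ℝ)) :=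
      measurable_const.indicator hs
    have hF : Measurable fun p : (ℝ × E) × S =>
        p.1.1 * ‖p.1.2 - wstar - η t • H p.1.2 p.2‖ ^ 2 :=
      (measurable_fst.comp measurable_fst).mul (((((measurable_snd.comp
        measurable_fst).sub_const wstar).sub ((hH.comp ((measurable_snd.comp
        measurable_fst).prodMk measurable_snd)).const_smul (η t))).norm).pow_const 2)
    have hmul : ∀ f : Ω → ℝ, (fun ω => s.indicator (fun _ => (1 : ℝ)) ω * f ω) =
        s.indicator f := fun f => by
      funext ω
      by_cases hω : ω ∈ s <;> simp [hω]
    have h1 := (hy_indep.indepFun_of_measurable_past hy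
      (hind.prodMk (hx_meas t))).integral_comp_eq_integral_integral
      ((hind.mono (ℱ.le t) le_rfl).prodMk (hx_meas' t)) (hy t) hF.stronglyMeasurable (by
        have := (hV_int (t + 1)).indicator hs'
        rw [hV_succ, ← hmul] at this
        exact this)
    simp only [integral_const_mul] at h1
    rw [hmul, integral_indicator hs', ← hV_succ] at h1
    have h2 : ∫ ω in s, V (t + 1) ω ∂μ = ∫ ω in s, φ t (x t ω) ∂μ := by
      rw [h1, ← integral_indicator hs', ← hmul fun ω => φ t (x t ω)]
    rw [h2]
    exact integral_mono_ae (hφ_int t (hV_int t)).integrableOn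
      ((((hV_int t).const_mul _).sub (hX_int t (hV_int t))).add
        (integrable_const _)).integrableOn (ae_restrict_of_ae (hdom t))
  have hrs := robbins_siegmund (fun t => (hV_meas t).stronglyMeasurable)
    (fun t => (hX_meas t).stronglyMeasurable) hV_int (fun t => hX_int t (hV_int t))
    (fun t ω => sq_nonneg _) hX_nonneg (fun t => mul_nonneg (sq_nonneg (η t)) hB)
    (fun t => mul_nonneg (sq_nonneg (η t)) hA) (hη_sq.mul_right B) (hη_sq.mul_right A) hstep
  filter_upwards [hrs, ae_all_iff.2 hW] with ω ⟨⟨l, hl⟩, hsum⟩ hω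
  refine tendsto_of_summable_descent hdescent hη hη_sum hω hl
    ((hsum.mul_left (1 / 2)).congr fun t => ?_)
  simp only [hX, hm]
  rw [hH_unbiased t _ (hω t)]
  ring

end RobbinsMonro

/-! ### Dithered quantization: mean and size -/

lemma measurable_uniformQuantizer (Δ : ℝ) : Measurable (uniformQuantizer Δ) := by
  have h : uniformQuantizer Δ = fun v => Δ * ((⌊v / Δ + 1 / 2⌋ : ℤ) : ℝ) := by
    funext v
    rw [uniformQuantizer, round_eq]
  rw [h]
  have h1 : Measurable fun v : ℝ => ⌊v / Δ + 1 / 2⌋ :=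
    ((measurable_id.div_const Δ).add_const _).floor
  exact ((measurable_from_top (f := fun k : ℤ => (k : ℝ))).comp h1).const_mul Δ

lemma measurable_ditheredQuantization {n : ℕ} (Δ : ℝ) :
    Measurable fun p : EuclideanSpace ℝ (Fin n) × (Fin n → ℝ) =>
      ditheredQuantization Δ p.1 p.2 := by
  unfold ditheredQuantization
  refine (WithLp.measurable_toLp 2 _).comp (measurable_pi_lambda _ fun i => ?_)
  have h0 : Measurable fun p : EuclideanSpace ℝ (Fin n) × (Fin n → ℝ) => WithLp.ofLp p.1 :=
    (WithLp.measurable_ofLp 2 _).comp measurable_fst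
  have h1 := h0.norm
  have h2 := (measurable_pi_apply i).comp h0
  have h3 : Measurable fun p : EuclideanSpace ℝ (Fin n) × (Fin n → ℝ) => p.2 i :=
    (measurable_pi_apply i).comp measurable_snd
  exact h1.mul (((measurable_uniformQuantizer Δ).comp ((h2.div h1).add h3)).sub h3)

lemma abs_uniformQuantizer_sub_le {Δ : ℝ} (hΔ : 0 < Δ) (v : ℝ) :
    |uniformQuantizer Δ v - v| ≤ Δ / 2 := by
  have h1 : uniformQuantizer Δ v - v = -(Δ * (v / Δ - round (v / Δ))) := by
    rw [uniformQuantizer]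
    field_simp
    ring
  rw [h1, abs_neg, abs_mul, abs_of_pos hΔ]
  linarith [mul_le_mul_of_nonneg_left (abs_sub_round (v / Δ)) hΔ.le]

lemma periodic_uniformQuantizer_sub {Δ : ℝ} (hΔ : 0 < Δ) :
    Function.Periodic (fun v => uniformQuantizer Δ v - v) Δ := fun v => by
  simp only [uniformQuantizer]
  rw [add_div, div_self hΔ.ne', round_add_one]
  push_cast
  ring

/-- By periodicity the shift `y` is irrelevant, and on the central cell the error is the odd
function `-x`. -/
lemma integral_uniformQuantizer_sub_period {Δ : ℝ} (hΔ : 0 < Δ) (y : ℝ) :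
    ∫ x in (-(Δ / 2))..(Δ / 2), (uniformQuantizer Δ (y + x) - (y + x)) = 0 := by
  rw [intervalIntegral.integral_comp_add_left (fun v => uniformQuantizer Δ v - v) y]
  have h1 := (periodic_uniformQuantizer_sub hΔ).intervalIntegral_add_eq (y + -(Δ / 2)) (-(Δ / 2))
  rw [show y + -(Δ / 2) + Δ = y + Δ / 2 by ring, show -(Δ / 2) + Δ = Δ / 2 by ring] at h1
  rw [h1, intervalIntegral.integral_of_le (by linarith), integral_Ioc_eq_integral_Ioo]
  -- The open interval avoids `Δ / 2`, where `round` gives `1`.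
  have h2 : ∫ x in Set.Ioo (-(Δ / 2)) (Δ / 2), (uniformQuantizer Δ x - x) =
      ∫ x in Set.Ioo (-(Δ / 2)) (Δ / 2), (-x) := by
    refine setIntegral_congr_fun measurableSet_Ioo fun x hx => ?_
    have : round (x / Δ) = 0 := by
      rw [round_eq_zero_iff]
      constructor
      · rw [le_div_iff₀ hΔ]; linarith [hx.1]
      · rw [div_lt_iff₀ hΔ]; linarith [hx.2]
    simp [uniformQuantizer, this]
  rw [h2, ← integral_Ioc_eq_integral_Ioo, ← intervalIntegral.integral_of_le (by linarith),
    intervalIntegral.integral_neg, integral_id]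
  ring

/-- Dithering makes the uniform quantizer unbiased. -/
lemma integral_uniformQuantizer_add_sub {Ω : Type*} [MeasurableSpace Ω] {μ : Measure Ω}
    {Δ : ℝ} (hΔ : 0 < Δ) {U : Ω → ℝ} (hU : Measurable U)
    (hunif : pdf.IsUniform U (Set.Icc (-(Δ / 2)) (Δ / 2)) μ volume) (y : ℝ) :
    ∫ ω, (uniformQuantizer Δ (y + U ω) - U ω) ∂μ = y := by
  have hm : Measurable fun x => uniformQuantizer Δ (y + x) - x :=
    ((measurable_uniformQuantizer Δ).comp (measurable_id.const_add y)).sub measurable_id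
  rw [← integral_map (φ := U) (f := fun x => uniformQuantizer Δ (y + x) - x)
    hU.aemeasurable hm.aestronglyMeasurable]
  have hvol : volume (Set.Icc (-(Δ / 2)) (Δ / 2)) = ENNReal.ofReal Δ := by
    rw [Real.volume_Icc]; congr 1; ring
  rw [pdf.IsUniform] at hunif
  rw [hunif, ProbabilityTheory.cond, integral_smul_measure, hvol, ENNReal.toReal_inv,
    ENNReal.toReal_ofReal hΔ.le, integral_Icc_eq_integral_Ioc,
    ← intervalIntegral.integral_of_le (by linarith)]
  have hb : IntervalIntegrable (fun x => uniformQuantizer Δ (y + x) - (y + x)) volume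
      (-(Δ / 2)) (Δ / 2) := by
    refine (intervalIntegrable_const (c := Δ / 2)).mono_fun ?_ ?_
    · exact (((measurable_uniformQuantizer Δ).comp (measurable_id.const_add y)).sub
        (measurable_id.const_add y)).aestronglyMeasurable
    · refine Eventually.of_forall fun x => ?_
      exact (abs_uniformQuantizer_sub_le hΔ _).trans (le_abs_self _)
  have e : (fun x => uniformQuantizer Δ (y + x) - x) =
      fun x => (uniformQuantizer Δ (y + x) - (y + x)) + y := by funext x; ring
  rw [e, intervalIntegral.integral_add hb intervalIntegrable_const,
    integral_uniformQuantizer_sub_period hΔ, intervalIntegral.integral_const, smul_eq_mul,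
    smul_eq_mul]
  field_simp
  ring

lemma norm_ofLp_le_norm {n : ℕ} (g : EuclideanSpace ℝ (Fin n)) : ‖WithLp.ofLp g‖ ≤ ‖g‖ :=
  (pi_norm_le_iff_of_nonneg (norm_nonneg g)).2 fun i => PiLp.norm_apply_le g i

lemma abs_ditheredQuantization_apply_le {n : ℕ} {Δ : ℝ} (hΔ : 0 < Δ) (hΔ' : Δ ≤ 1)
    (g : EuclideanSpace ℝ (Fin n)) (u : Fin n → ℝ) (i : Fin n) :
    |ditheredQuantization Δ g u i| ≤ 2 * ‖g‖ := by
  have hκ := norm_ofLp_le_norm g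
  have h0 := norm_nonneg (WithLp.ofLp g)
  set κ := ‖WithLp.ofLp g‖ with hκdef
  -- This includes `κ = 0`, where the quotient is `0`.
  have hdiv : |g i / κ| ≤ 1 := by
    rw [abs_div, abs_of_nonneg h0]
    exact div_le_one_of_le₀ (norm_le_pi_norm (WithLp.ofLp g) i) h0
  have h1 := abs_uniformQuantizer_sub_le hΔ (g i / κ + u i)
  -- The quantity is `g i / κ` plus an error of at most `Δ / 2 ≤ 1 / 2`, whatever the dither; `2` is
  -- a rounded-up `3 / 2`.
  have h2 : |uniformQuantizer Δ (g i / κ + u i) - u i| ≤ 2 := by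
    rw [abs_le] at hdiv h1 ⊢
    constructor <;> linarith [hdiv.1, hdiv.2, h1.1, h1.2]
  change |κ * (uniformQuantizer Δ (g i / κ + u i) - u i)| ≤ _
  rw [abs_mul, abs_of_nonneg h0]
  nlinarith [abs_nonneg (uniformQuantizer Δ (g i / κ + u i) - u i)]

lemma norm_ditheredQuantization_sq_le {n : ℕ} {Δ : ℝ} (hΔ : 0 < Δ) (hΔ' : Δ ≤ 1)
    (g : EuclideanSpace ℝ (Fin n)) (u : Fin n → ℝ) :
    ‖ditheredQuantization Δ g u‖ ^ 2 ≤ 4 * n * ‖g‖ ^ 2 := by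
  rw [EuclideanSpace.norm_sq_eq]
  calc ∑ i, ‖ditheredQuantization Δ g u i‖ ^ 2 ≤ ∑ _i : Fin n, (2 * ‖g‖) ^ 2 :=
        Finset.sum_le_sum fun i _ => pow_le_pow_left₀ (norm_nonneg _)
          (abs_ditheredQuantization_apply_le hΔ hΔ' g u i) 2
    _ = 4 * n * ‖g‖ ^ 2 := by simp; ring

/-- Dithered quantization is unbiased. -/
lemma integral_ditheredQuantization {n : ℕ} {Ω : Type*} [MeasurableSpace Ω] {μ : Measure Ω}
    [IsFiniteMeasure μ] {Δ : ℝ} (hΔ : 0 < Δ) (hΔ' : Δ ≤ 1) {U : Ω → Fin n → ℝ} (hU : Measurable U)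
    (hunif : ∀ i, pdf.IsUniform (fun ω => U ω i) (Set.Icc (-(Δ / 2)) (Δ / 2)) μ volume)
    (g : EuclideanSpace ℝ (Fin n)) :
    ∫ ω, ditheredQuantization Δ g (U ω) ∂μ = g := by
  have hm : Measurable fun ω => ditheredQuantization Δ g (U ω) :=
    (measurable_ditheredQuantization Δ).comp (measurable_const.prodMk hU)
  have hint : Integrable (fun ω => ditheredQuantization Δ g (U ω)) μ := by
    refine Integrable.of_bound hm.aestronglyMeasurable (√(4 * n * ‖g‖ ^ 2))
      (Eventually.of_forall fun ω => ?_)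
    exact Real.le_sqrt_of_sq_le (norm_ditheredQuantization_sq_le hΔ hΔ' g (U ω))
  ext i
  have h1 := (EuclideanSpace.proj i : EuclideanSpace ℝ (Fin n) →L[ℝ] ℝ).integral_comp_comm hint
  change _ = (∫ ω, ditheredQuantization Δ g (U ω) ∂μ) i at h1
  rw [← h1]
  change ∫ ω, ‖WithLp.ofLp g‖ * (uniformQuantizer Δ (g i / ‖WithLp.ofLp g‖ + U ω i) - U ω i) ∂μ = _
  rw [integral_const_mul, integral_uniformQuantizer_add_sub (U := fun ω => U ω i) hΔ
    ((measurable_pi_apply i).comp hU) (hunif i)]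
  rcases eq_or_ne ‖WithLp.ofLp g‖ 0 with h | h
  · rw [h, zero_mul, norm_eq_zero.1 h, Pi.zero_apply]
  · exact mul_div_cancel₀ _ h

lemma memLp_ditheredQuantization {n : ℕ} {Ω : Type*} [MeasurableSpace Ω] {μ : Measure Ω}
    {Δ : ℝ} (hΔ : 0 < Δ) (hΔ' : Δ ≤ 1) {g : Ω → EuclideanSpace ℝ (Fin n)} (hg : Measurable g)
    (hg2 : MemLp g 2 μ) {U : Ω → Fin n → ℝ} (hU : Measurable U) :
    MemLp (fun ω => ditheredQuantization Δ (g ω) (U ω)) 2 μ := by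
  refine hg2.of_le_mul (c := √(4 * n))
    ((measurable_ditheredQuantization Δ).comp (hg.prodMk hU)).aestronglyMeasurable
    (Eventually.of_forall fun ω => ?_)
  refine (Real.le_sqrt_of_sq_le (norm_ditheredQuantization_sq_le hΔ hΔ' (g ω) (U ω))).trans_eq ?_
  rw [Real.sqrt_mul (by positivity), Real.sqrt_sq (norm_nonneg _)]

/-- Dithered quantization of a random vector preserves its mean, for an independent dither. -/
lemma integral_ditheredQuantization_comp {n : ℕ} {Ω Ξ : Type*} [MeasurableSpace Ω]
    [MeasurableSpace Ξ] {μ : Measure Ω} [IsProbabilityMeasure μ] {Δ : ℝ} (hΔ : 0 < Δ)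
    (hΔ' : Δ ≤ 1) {g : Ξ → EuclideanSpace ℝ (Fin n)} (hg : Measurable g) {ξ : Ω → Ξ}
    (hξ : Measurable ξ) (hg2 : MemLp (fun ω => g (ξ ω)) 2 μ) {U : Ω → Fin n → ℝ}
    (hU : Measurable U)
    (hunif : ∀ i, pdf.IsUniform (fun ω => U ω i) (Set.Icc (-(Δ / 2)) (Δ / 2)) μ volume)
    (hindep : IndepFun ξ U μ) :
    ∫ ω, ditheredQuantization Δ (g (ξ ω)) (U ω) ∂μ = ∫ ω, g (ξ ω) ∂μ := by
  have hF : Measurable fun p : Ξ × (Fin n → ℝ) => ditheredQuantization Δ (g p.1) p.2 :=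
    (measurable_ditheredQuantization Δ).comp ((hg.comp measurable_fst).prodMk measurable_snd)
  rw [hindep.integral_comp_eq_integral_integral hξ hU hF.stronglyMeasurable
    ((memLp_ditheredQuantization hΔ hΔ' (hg.comp hξ) hg2 hU).integrable one_le_two)]
  simp only [integral_ditheredQuantization hΔ hΔ' hU hunif]

/-! ### Convergence of dithered SGD -/

theorem mainTheorem2 {n : ℕ} {Ω Ξ : Type*} [MeasurableSpace Ω] [MeasurableSpace Ξ]
    (μ : Measure Ω) [IsProbabilityMeasure μ]
    -- the loss `L` on the parameter set `W`, with gradient `gradL` and single minimum `wstar`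
    (W : Set (EuclideanSpace ℝ (Fin n))) (L : EuclideanSpace ℝ (Fin n) → ℝ)
    (gradL : EuclideanSpace ℝ (Fin n) → EuclideanSpace ℝ (Fin n))
    (hgrad : ∀ w ∈ W, HasGradientWithinAt L (gradL w) W w)
    (wstar : EuclideanSpace ℝ (Fin n)) (hmin : IsUniqueMinOn L W wstar)
    (hdescent : ∀ ε : ℝ, 0 < ε →
      (0 : EReal) < ⨅ w ∈ {w ∈ W | ε < ‖w - wstar‖},
        ((inner ℝ (w - wstar) (gradL w) : ℝ) : EReal))
    -- the step sizes
    (η : ℕ → ℝ) (hη : ∀ t, 0 ≤ η t)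
    (hη_sum : Tendsto (fun T => ∑ t ∈ Finset.range T, η t) atTop atTop)
    (hη_sq : Summable fun t => η t ^ 2)
    -- the stochastic gradients `G w (ξ t)`: square integrable, unbiased, with bounded growth
    (G : EuclideanSpace ℝ (Fin n) → Ξ → EuclideanSpace ℝ (Fin n))
    (hG : Measurable (Function.uncurry G))
    (ξ : ℕ → Ω → Ξ) (hξ : ∀ t, Measurable (ξ t))
    (hG_L2 : ∀ t, ∀ w ∈ W, MemLp (fun ω => G w (ξ t ω)) 2 μ)
    (hG_unbiased : ∀ t, ∀ w ∈ W, ∫ ω, G w (ξ t ω) ∂μ = gradL w)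
    (A B : ℝ)
    (hG_bound : ∀ t, ∀ w ∈ W, ∫ ω, ‖G w (ξ t ω)‖ ^ 2 ∂μ ≤ A + B * ‖w - wstar‖ ^ 2)
    -- the quantization step size and the dithers
    (Δ : ℝ) (hΔ_pos : 0 < Δ) (hΔ_le : Δ ≤ 1)
    (u : ℕ → Ω → Fin n → ℝ) (hu : IsUniformDither μ Δ u)
    -- all the samples `ξ t` and all the dithers `u t` are mutually independent
    (h_indep : iIndepFun (fun t ω => (ξ t ω, u t ω)) μ)
    (h_indep_dither : ∀ t, IndepFun (ξ t) (u t) μ)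
    -- the iterates are admissible parameters (automatic when `W` is the whole space)
    (w₀ : EuclideanSpace ℝ (Fin n))
    (hW : ∀ t, ∀ᵐ ω ∂μ, ditheredSGD Δ η G ξ u w₀ t ω ∈ W) :
    ∀ᵐ ω ∂μ, Tendsto (fun t => ditheredSGD Δ η G ξ u w₀ t ω) atTop (𝓝 wstar) := by

  have hdescent' : ∀ ε : ℝ, 0 < ε → ∃ δ : ℝ, 0 < δ ∧ ∀ w ∈ W, ε < ‖w - wstar‖ →
      δ ≤ inner ℝ (w - wstar) (gradL w) := fun ε hε => by
    -- The infimum may be `⊤`, so a real `δ` is chosen strictly below it.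
    obtain ⟨δ, hδ, hlt⟩ := EReal.lt_iff_exists_real_btwn.1 (hdescent ε hε)
    refine ⟨δ, EReal.coe_pos.1 hδ, fun w hw hwε => EReal.coe_le_coe_iff.1 ?_⟩
    exact hlt.le.trans (iInf₂_le w ⟨hw, hwε⟩)
  have hGw : ∀ w, Measurable (G w) := fun w => hG.of_uncurry_left
  -- `4 * n` is the loss from quantization; absolute values make the growth constants nonnegative,
  -- as the perturbation terms require.
  refine ae_tendsto_of_robbins_monro (W := W) (gradL := gradL) (S := Ξ × (Fin n → ℝ))
    (H := fun w p => ditheredQuantization Δ (G w p.1) p.2) (y := fun t ω => (ξ t ω, u t ω))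
    (A := 4 * n * |A|) (B := 4 * n * |B|) (w₀ := w₀) hdescent' hη hη_sum hη_sq ?_
    (fun t => (hξ t).prodMk (hu t).1) h_indep
    (fun t w hw => memLp_ditheredQuantization hΔ_pos hΔ_le ((hGw w).comp (hξ t)) (hG_L2 t w hw)
      (hu t).1)
    (fun t w hw => (integral_ditheredQuantization_comp hΔ_pos hΔ_le (hGw w) (hξ t)
      (hG_L2 t w hw) (hu t).1 (hu t).2 (h_indep_dither t)).trans (hG_unbiased t w hw))
    (by positivity) (by positivity) (fun t w hw => ?_) (fun ω => rfl) (fun t ω => rfl) hW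
  · exact (measurable_ditheredQuantization Δ).comp ((hG.comp (measurable_fst.prodMk
      (measurable_fst.comp measurable_snd))).prodMk (measurable_snd.comp measurable_snd))
  · have h1 : Integrable (fun ω => ‖G w (ξ t ω)‖ ^ 2) μ :=
      (hG_L2 t w hw).integrable_norm_pow two_ne_zero
    have h2 : Integrable (fun ω => ‖ditheredQuantization Δ (G w (ξ t ω)) (u t ω)‖ ^ 2) μ :=
      (memLp_ditheredQuantization hΔ_pos hΔ_le ((hGw w).comp (hξ t)) (hG_L2 t w hw)
        (hu t).1).integrable_norm_pow two_ne_zero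
    calc ∫ ω, ‖ditheredQuantization Δ (G w (ξ t ω)) (u t ω)‖ ^ 2 ∂μ
        ≤ ∫ ω, 4 * n * ‖G w (ξ t ω)‖ ^ 2 ∂μ := integral_mono h2 (h1.const_mul _) fun ω =>
          norm_ditheredQuantization_sq_le hΔ_pos hΔ_le _ _
      _ = 4 * n * ∫ ω, ‖G w (ξ t ω)‖ ^ 2 ∂μ := integral_const_mul _ _
      _ ≤ 4 * n * (|A| + |B| * ‖w - wstar‖ ^ 2) := by
          refine mul_le_mul_of_nonneg_left ((hG_bound t w hw).trans ?_) (by positivity)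
          gcongr <;> exact le_abs_self _
      _ = _ := by ring
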